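/- Let $k$ be a field. A \emph{finite abelian category} over $k$ is a $k$-linear abelian category that is equivalent, as a $k$-linear category, to the category of finite-dimensional right modules over some finite-dimensional $k$-algebra. A \emph{finite tensor category} over $k$ is a finite abelian category $\mathcal{C}$ with a rigid monoidal structure such that $\otimes$ is $k$-bilinear on morphisms and the unit object $\mathbf{1}$ is simple. A \emph{tensor functor} between finite tensor categories is a (strong) monoidal functor that is $k$-linear, exact and faithful. Let $A$ be an algebra (monoid object) in a finite tensor category $\mathcal{C}$. The category $\mathcal{C}_A$ of right $A$-modules in $\mathcal{C}$ is a left $\mathcal{C}$-module category by $(X, M) \mapsto X \otimes M$, where $A$ acts on $M$. Its internal Hom functor $\underline{\mathrm{Hom}} : \mathcal{C}_A^{\mathrm{op}} \times \mathcal{C}_A \to \mathcal{C}$ is characterized by isomorphisms \[ \mathrm{Hom}_{\mathcal{C}_A}(X \otimes M, N) \cong \mathrm{Hom}_{\mathcal{C}}(X, \underline{\mathrm{Hom}}(M, N)) \] natural in $X \in \mathcal{C}$ and $M, N \in \mathcal{C}_A$. An object $N \in \mathcal{C}_A$ is \emph{$\mathcal{C}$-injective} if the functor $\underline{\mathrm{Hom}}(-,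 N) : \mathcal{C}_A^{\mathrm{op}} \to \mathcal{C}$ is exact, and the algebra $A$ is \emph{quasi-Frobenius} if $A$, as a right module over itself, is $\mathcal{C}$-injective in $\mathcal{C}_A$. \textbf{Corollary.} Let $F : \mathcal{C} \to \mathcal{D}$ be a tensor functor between finite tensor categories over $k$, and let $A$ be a quasi-Frobenius algebra in $\mathcal{C}$. Then $F(A)$, with the algebra structure induced from $A$ by the monoidal structure of $F$, is a quasi-Frobenius algebra in $\mathcal{D}$. -/

import Mathlib

open CategoryTheory MonoidalCategory Limits Opposite
open scoped MonoidalLeftAction MonObj CategoryTheory.Obj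

universe w v u v₁ u₁ v₂ u₂

/-! ### Finite abelian categories, finite tensor categories and tensor functors -/

section FiniteTensorCategories

open scoped ModuleCat in
/-- A `k`-linear abelian category is finite if it is equivalent, as a `k`-linear category, to the
category of finite-dimensional right modules over some finite-dimensional `k`-algebra `R`.
Right `R`-modules are modules over `Rᵐᵒᵖ`; since `R` is finite-dimensional over `k`, the
finite-dimensional modules are exactly the finitely generated ones. -/
def IsFiniteAbelian (k : Type w) [Field k] (C : Type u) [Category.{v} C] [Preadditive C]
    [Linear k C] : Prop :=
  ∃ (R : Type w) (_ : Ring R) (_ : Algebra k R) (_ : Module.Finite k R)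
    (e : C ≌ FGModuleCat.{w} Rᵐᵒᵖ), e.functor.Additive ∧ e.functor.Linear k

/-- A finite tensor category over `k`: a finite abelian category with a rigid monoidal structure
whose tensor product is bilinear on morphisms and whose unit object is simple. -/
class FiniteTensorCategory (k : Type w) [Field k] (C : Type u) [Category.{v} C] [Abelian C]
    [Linear k C] [MonoidalCategory C] [RigidCategory C] : Prop where
  finite : IsFiniteAbelian k C
  tensor_additive : MonoidalPreadditive C
  tensor_linear : MonoidalLinear k C
  simple_unit : Simple (𝟙_ C)

/-- A tensor functor over `k`: a (strong) monoidal functor that is `k`-linear, exact and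
faithful. -/
class TensorFunctor (k : Type w) [Field k]
    {C : Type u₁} [Category.{v₁} C] [Preadditive C] [Linear k C] [MonoidalCategory C]
    {D : Type u₂} [Category.{v₂} D] [Preadditive D] [Linear k D] [MonoidalCategory D]
    (F : C ⥤ D) [F.Monoidal] : Prop where
  additive : F.Additive
  linear : F.Linear k
  left_exact : PreservesFiniteLimits F
  right_exact : PreservesFiniteColimits F
  faithful : F.Faithful

end FiniteTensorCategories

/-! ### Relative injectivity in module categories -/

section ModuleCategories

/-- `C`-injectivity of an object `N` of a left `C`-module category `M`.
The internal Hom is the functor `iHom : Mᵒᵖ ⥤ M ⥤ C`, unique up to unique isomorphism, with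
isomorphisms `Hom_M (X ⊙ₗ P, N) ≅ Hom_C (X, iHom (P, N))` natural in `X`, `P` and `N`.
The object `N` is `C`-injective if the functor `iHom (-, N) : Mᵒᵖ ⥤ C` is exact. -/
def IsRelativelyInjective (C : Type u₁) [Category.{v₁} C] [MonoidalCategory C]
    {M : Type u₂} [Category.{v₂} M] [MonoidalLeftAction C M] (N : M) : Prop :=
  ∃ iHom : Mᵒᵖ ⥤ M ⥤ C,
    Nonempty ((MonoidalLeftAction.curriedAction C M).flip ⊣₂ iHom) ∧
      PreservesFiniteLimits (iHom.flip.obj N) ∧ PreservesFiniteColimits (iHom.flip.obj N)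

end ModuleCategories

/-! ### Right modules over an algebra in a monoidal category -/

/-- A right module over an algebra (monoid object) `A` in a monoidal category. -/
structure RightModule {C : Type u} [Category.{v} C] [MonoidalCategory C]
    (A : C) [MonObj A] where
  /-- the underlying object -/
  X : C
  /-- the action of `A` -/
  act : X ⊗ A ⟶ X
  act_one : X ◁ η[A] ≫ act = (ρ_ X).hom
  act_mul : X ◁ μ[A] ≫ act = (α_ X A A).inv ≫ act ▷ A ≫ act

namespace RightModule

variable {C : Type u} [Category.{v} C] [MonoidalCategory C] {A : C} [MonObj A]

/-- A morphism of right `A`-modules. -/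
@[ext]
structure Hom (M N : RightModule A) where
  /-- the underlying morphism -/
  hom : M.X ⟶ N.X
  act_hom : M.act ≫ hom = hom ▷ A ≫ N.act

/-- The category of right `A`-modules in `C`. -/
instance : Category (RightModule A) where
  Hom M N := Hom M N
  id M := ⟨𝟙 M.X, by simp⟩
  comp f g := ⟨f.hom ≫ g.hom, by
    rw [← Category.assoc, f.act_hom, Category.assoc, g.act_hom, comp_whiskerRight, Category.assoc]⟩

@[ext]
theorem hom_ext {M N : RightModule A} {f g : M ⟶ N} (h : f.hom = g.hom) : f = g :=
  Hom.ext h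

@[simp]
theorem id_hom (M : RightModule A) : Hom.hom (𝟙 M) = 𝟙 M.X := rfl

@[simp]
theorem comp_hom {M N K : RightModule A} (f : M ⟶ N) (g : N ⟶ K) :
    (f ≫ g).hom = f.hom ≫ g.hom := rfl

/-- An isomorphism of underlying objects compatible with the actions is an isomorphism of
modules. -/
@[simps]
def isoMk {M N : RightModule A} (e : M.X ≅ N.X) (h : M.act ≫ e.hom = e.hom ▷ A ≫ N.act) :
    M ≅ N where
  hom := ⟨e.hom, h⟩
  inv := ⟨e.inv, by
    rw [Iso.comp_inv_eq, Category.assoc, h, ← comp_whiskerRight_assoc]; simp⟩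

variable (A) in
/-- The algebra `A` as a right module over itself. -/
@[simps]
def regular : RightModule A where
  X := A
  act := μ[A]
  act_one := MonObj.mul_one A
  act_mul := by simp [MonObj.mul_assoc]

/-- The right `A`-module `Y ⊗ M`, with `A` acting on `M`. -/
@[simps]
def tensor (Y : C) (M : RightModule A) : RightModule A where
  X := Y ⊗ M.X
  act := (α_ Y M.X A).hom ≫ Y ◁ M.act
  act_one := by
    rw [associator_naturality_right_assoc, ← MonoidalCategory.whiskerLeft_comp, act_one]
    simp
  act_mul := by
    rw [associator_naturality_right_assoc, ← MonoidalCategory.whiskerLeft_comp, act_mul]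
    simp

/-- A morphism `f : Y ⟶ Z` in `C` induces a morphism of modules `f ⊗ M`. -/
@[simps]
def tensorHomLeft {Y Z : C} (f : Y ⟶ Z) (M : RightModule A) : tensor Y M ⟶ tensor Z M where
  hom := f ▷ M.X
  act_hom := by
    change ((α_ Y M.X A).hom ≫ Y ◁ M.act) ≫ f ▷ M.X =
      (f ▷ M.X) ▷ A ≫ (α_ Z M.X A).hom ≫ Z ◁ M.act
    rw [Category.assoc, whisker_exchange, whiskerRight_tensor]
    simp

/-- A morphism of modules `g : M ⟶ N` induces a morphism of modules `Y ⊗ g`. -/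
@[simps]
def tensorHomRight (Y : C) {M N : RightModule A} (g : M ⟶ N) : tensor Y M ⟶ tensor Y N where
  hom := Y ◁ g.hom
  act_hom := by
    change ((α_ Y M.X A).hom ≫ Y ◁ M.act) ≫ Y ◁ g.hom =
      (Y ◁ g.hom) ▷ A ≫ (α_ Y N.X A).hom ≫ Y ◁ N.act
    rw [Category.assoc, ← MonoidalCategory.whiskerLeft_comp, g.act_hom]
    simp

/-- The associativity isomorphism of modules `(Y ⊗ Z) ⊗ M ≅ Y ⊗ (Z ⊗ M)`. -/
@[simps!]
def tensorAssoc (Y Z : C) (M : RightModule A) : tensor (Y ⊗ Z) M ≅ tensor Y (tensor Z M) :=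
  isoMk (α_ Y Z M.X) (by
    change ((α_ (Y ⊗ Z) M.X A).hom ≫ (Y ⊗ Z) ◁ M.act) ≫ (α_ Y Z M.X).hom =
      (α_ Y Z M.X).hom ▷ A ≫ (α_ Y (Z ⊗ M.X) A).hom ≫ Y ◁ ((α_ Z M.X A).hom ≫ Z ◁ M.act)
    simp)

/-- The unit isomorphism of modules `𝟙 ⊗ M ≅ M`. -/
@[simps!]
def tensorUnit (M : RightModule A) : tensor (𝟙_ C) M ≅ M :=
  isoMk (λ_ M.X) (by
    change ((α_ (𝟙_ C) M.X A).hom ≫ 𝟙_ C ◁ M.act) ≫ (λ_ M.X).hom = (λ_ M.X).hom ▷ A ≫ M.act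
    simp)

/-- The left `C`-module category structure on right `A`-modules given by the tensor product. -/
instance : MonoidalLeftAction C (RightModule A) where
  actionObj Y M := tensor Y M
  actionHomLeft f M := tensorHomLeft f M
  actionHomRight Y _ _ g := tensorHomRight Y g
  actionHom f g := ⟨f ⊗ₘ g.hom, by
    rw [MonoidalCategory.tensorHom_def]
    exact (tensorHomLeft f _ ≫ tensorHomRight _ g).act_hom⟩
  actionAssocIso Y Z M := tensorAssoc Y Z M
  actionUnitIso M := tensorUnit M
  actionHom_def f g := hom_ext (MonoidalCategory.tensorHom_def f g.hom)
  actionHomRight_id Y M := hom_ext (MonoidalCategory.whiskerLeft_id Y M.X)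
  id_actionHomLeft Y M := hom_ext (id_whiskerRight Y M.X)
  actionHom_comp f₁ f₂ g₁ g₂ :=
    hom_ext (MonoidalLeftAction.actionHom_comp (D := C) f₁ f₂ g₁.hom g₂.hom)
  actionAssocIso_hom_naturality f g h :=
    hom_ext (MonoidalLeftAction.actionAssocIso_hom_naturality (D := C) f g h.hom)
  actionUnitIso_hom_naturality g :=
    hom_ext (MonoidalLeftAction.actionUnitIso_hom_naturality (C := C) (D := C) g.hom)
  whiskerLeft_actionHomLeft Y _ _ f M :=
    hom_ext (MonoidalLeftAction.whiskerLeft_actionHomLeft (D := C) Y f M.X)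
  whiskerRight_actionHomLeft Z f M :=
    hom_ext (MonoidalLeftAction.whiskerRight_actionHomLeft (D := C) Z f M.X)
  associator_actionHom Y₁ Y₂ Y₃ M :=
    hom_ext (MonoidalLeftAction.associator_actionHom (D := C) Y₁ Y₂ Y₃ M.X)
  leftUnitor_actionHom Y M :=
    hom_ext (MonoidalLeftAction.leftUnitor_actionHom (D := C) Y M.X)
  rightUnitor_actionHom Y M :=
    hom_ext (MonoidalLeftAction.rightUnitor_actionHom (D := C) Y M.X)

end RightModule

/-! ### Quasi-Frobenius algebras -/

/-- An algebra `A` in `C` is quasi-Frobenius if the right `A`-module `A` is `C`-injective. -/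
def IsQuasiFrobenius {C : Type u} [Category.{v} C] [MonoidalCategory C] (A : C) [MonObj A] :
    Prop :=
  IsRelativelyInjective C (RightModule.regular A)

/-! The internal Hom Hom(-, N) is always left exact, so C-injectivity is a question of preserving
finite colimits. The idea is to restate it as a splitting, because a monoidal functor carries
retracts to retracts; the internal Homs over A and over F(A) never have to be compared.

Let A* be the dual of A as a right module. The modules X ⊗ A* are cofree, and Hom(M, X ⊗ A*) ≅ X ⊗
M*, which is exact in M (`preservesFiniteColimits_iHom_tensor_dual`). The unit of the cofree
construction is a monomorphism A → A ⊗ A*. If A is quasi-Frobenius, Hom(-, P ⊗ A) ≅ P ⊗ Hom(-, A)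
sends it to an epimorphism. For projective P, the element P → Hom(A, P ⊗ A) given by the identity
lifts along this epimorphism, and the lift splits P ⊗ A → P ⊗ A ⊗ A*
(`exists_retract_of_isQuasiFrobenius`).

Applying F makes F(P) ⊗ F(A) a retract of F(P ⊗ A) ⊗ F(A*), which is cofree because F(A*) is dual to
F(A). Hence F(P) ⊗ Hom(-, F(A)) preserves finite colimits. With P nonzero and F faithful, F(P) is
nonzero; since the unit of D is simple, F(P) ⊗ - reflects finite colimits
(`preservesFiniteColimits_of_comp_tensorLeft`), and F(P) can be cancelled. -/

/-! ### Isomorphisms of functors from natural bijections -/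

section

variable {J : Type u₁} [Category.{v₁} J] {C : Type u₂} [Category.{v₂} C]

/-- Two functors representing naturally isomorphic families of presheaves are isomorphic. -/
def isoOfHomEquiv {G₁ G₂ : J ⥤ C} (e : ∀ (X : C) (j : J), (X ⟶ G₁.obj j) ≃ (X ⟶ G₂.obj j))
    (he : ∀ {X Y : C} (j : J) (f : X ⟶ Y) (g : Y ⟶ G₁.obj j), e X j (f ≫ g) = f ≫ e Y j g)
    (he' : ∀ {X : C} {i j : J} (φ : i ⟶ j) (g : X ⟶ G₁.obj i),
      e X j (g ≫ G₁.map φ) = e X i g ≫ G₂.map φ) : G₁ ≅ G₂ :=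
  NatIso.ofComponents
    (fun j =>
      { hom := e _ j (𝟙 _)
        inv := (e _ j).symm (𝟙 _)
        hom_inv_id := by
          apply (e _ j).injective
          rw [he, Equiv.apply_symm_apply, Category.comp_id]
        inv_hom_id := by
          rw [← he, Category.comp_id, Equiv.apply_symm_apply] })
    (fun {i j} φ => by
      change G₁.map φ ≫ e _ j (𝟙 _) = e _ i (𝟙 _) ≫ G₂.map φ
      rw [← he, ← he', Category.comp_id, Category.id_comp])

/-- A retract of a functor preserving colimits preserves colimits. -/
theorem preservesColimitsOfShape_of_retract {K : Type u} [Category.{v} K] {G₁ G₂ : J ⥤ C}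
    (r : Retract G₁ G₂) [PreservesColimitsOfShape K G₂] : PreservesColimitsOfShape K G₁ where
  preservesColimit {D} :=
    { preserves := fun {c} hc => ⟨by
        have h₂ : IsColimit (G₂.mapCocone c) := isColimitOfPreserves G₂ hc
        refine
          -- A cocone on `G₁` is pulled back along the retraction to a cocone on `G₂`, descended
          -- there, and restricted along the section.
          { desc := fun s => r.i.app c.pt ≫ h₂.desc
              ⟨s.pt, Functor.whiskerLeft D r.r ≫ s.ι⟩
            fac := fun s j => ?_
            uniq := fun s m hm => ?_ }
        · have h := h₂.fac ⟨s.pt, Functor.whiskerLeft D r.r ≫ s.ι⟩ j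
          have hr := NatTrans.congr_app r.retract (D.obj j)
          dsimp at h hr ⊢
          rw [r.i.naturality_assoc, h, reassoc_of% hr]
        · have hr := NatTrans.congr_app r.retract c.pt
          dsimp at hr m ⊢
          rw [← Category.id_comp m, ← hr, Category.assoc]
          congr 1
          refine h₂.uniq ⟨s.pt, Functor.whiskerLeft D r.r ≫ s.ι⟩ _ fun j => ?_
          have := hm j
          dsimp at this ⊢
          rw [r.r.naturality_assoc, this]⟩ }

theorem preservesFiniteColimits_of_retract {G₁ G₂ : J ⥤ C}
    (r : Retract G₁ G₂) [PreservesFiniteColimits G₂] : PreservesFiniteColimits G₁ :=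
  ⟨fun _ _ _ => preservesColimitsOfShape_of_retract r⟩

end

/-! ### Duality and internal Homs for right modules -/

namespace RightModule

variable {C : Type u} [Category.{v} C] [MonoidalCategory C] {A : C} [MonObj A]

/-- The bijection `Hom (Y' ⊗ M, N) ≃ Hom (M, Y ⊗ N)` for right modules given by an exact pairing
of `Y` and `Y'`. -/
def tensorHomEquiv (Y Y' : C) [ExactPairing Y Y'] (M N : RightModule A) :
    (tensor Y' M ⟶ N) ≃ (M ⟶ tensor Y N) where
  toFun f := (tensorUnit M).inv ≫ tensorHomLeft (ExactPairing.coevaluation Y Y') M ≫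
    (tensorAssoc Y Y' M).hom ≫ tensorHomRight Y f
  invFun f := tensorHomRight Y' f ≫ (tensorAssoc Y' Y N).inv ≫
    tensorHomLeft (ExactPairing.evaluation Y Y') N ≫ (tensorUnit N).hom
  -- On underlying morphisms these are the duality bijections of `C`, so the inverse laws are
  -- inherited.
  left_inv f := hom_ext ((tensorLeftHomEquiv M.X Y Y' N.X).left_inv f.hom)
  right_inv f := hom_ext ((tensorLeftHomEquiv M.X Y Y' N.X).right_inv f.hom)

theorem tensorHomEquiv_naturality_left {Y Y' : C} [ExactPairing Y Y'] {M M' N : RightModule A}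
    (φ : M ⟶ M') (f : tensor Y' M' ⟶ N) :
    tensorHomEquiv Y Y' M N (tensorHomRight Y' φ ≫ f) = φ ≫ tensorHomEquiv Y Y' M' N f := by
  rw [← Equiv.eq_symm_apply]
  apply hom_ext
  have h : ∀ g : M'.X ⟶ Y ⊗ N.X, Y' ◁ φ.hom ≫ (tensorLeftHomEquiv M'.X Y Y' N.X).symm g =
      (tensorLeftHomEquiv M.X Y Y' N.X).symm (φ.hom ≫ g) := fun g =>
    (tensorLeftHomEquiv_symm_naturality _ _).symm
  refine Eq.trans ?_ (h _)
  exact congrArg (Y' ◁ φ.hom ≫ ·) (Equiv.symm_apply_apply _ _).symm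

theorem tensorHomEquiv_symm_naturality_left {Y Y' : C} [ExactPairing Y Y'] {M M' N : RightModule A}
    (φ : M ⟶ M') (f : M' ⟶ tensor Y N) :
    (tensorHomEquiv Y Y' M N).symm (φ ≫ f) =
      tensorHomRight Y' φ ≫ (tensorHomEquiv Y Y' M' N).symm f := by
  rw [Equiv.symm_apply_eq, tensorHomEquiv_naturality_left, Equiv.apply_symm_apply]

theorem tensorHomLeft_tensorAssoc_hom {Y X X' : C} (f : X ⟶ X') (M : RightModule A) :
    tensorHomLeft (Y ◁ f) M ≫ (tensorAssoc Y X' M).hom =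
      (tensorAssoc Y X M).hom ≫ tensorHomRight Y (tensorHomLeft f M) :=
  hom_ext (associator_naturality_middle Y f M.X)

theorem tensorHomRight_tensorAssoc_hom {Y X : C} {M M' : RightModule A} (f : M ⟶ M') :
    tensorHomRight (Y ⊗ X) f ≫ (tensorAssoc Y X M').hom =
      (tensorAssoc Y X M).hom ≫ tensorHomRight Y (tensorHomRight X f) :=
  hom_ext (associator_naturality_right Y X f.hom)

section InternalHom

variable {H : (RightModule A)ᵒᵖ ⥤ RightModule A ⥤ C}
  (adj : (MonoidalLeftAction.curriedAction C (RightModule A)).flip ⊣₂ H)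

/-- The bijection characterizing the internal Hom of right modules. -/
def iHomEquiv (X : C) (M N : RightModule A) :
    (tensor X M ⟶ N) ≃ (X ⟶ (H.flip.obj N).obj (op M)) :=
  adj.homEquiv (X₁ := M) (X₂ := X) (X₃ := N)

theorem iHomEquiv_naturality_left {X X' : C} {M N : RightModule A} (f : X ⟶ X')
    (g : tensor X' M ⟶ N) :
    iHomEquiv adj X M N (tensorHomLeft f M ≫ g) = f ≫ iHomEquiv adj X' M N g :=
  adj.homEquiv_naturality_two (X₁ := M) f g

theorem iHomEquiv_naturality_middle {X : C} {M M' N : RightModule A} (f : M ⟶ M')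
    (g : tensor X M' ⟶ N) :
    iHomEquiv adj X M N (tensorHomRight X f ≫ g) =
      iHomEquiv adj X M' N g ≫ (H.flip.obj N).map f.op :=
  adj.homEquiv_naturality_one f g

theorem iHomEquiv_symm_naturality_left {X X' : C} {M N : RightModule A} (f : X ⟶ X')
    (g : X' ⟶ (H.flip.obj N).obj (op M)) :
    (iHomEquiv adj X M N).symm (f ≫ g) = tensorHomLeft f M ≫ (iHomEquiv adj X' M N).symm g := by
  rw [Equiv.symm_apply_eq, iHomEquiv_naturality_left, Equiv.apply_symm_apply]

theorem iHomEquiv_symm_naturality_middle {X : C} {M M' N : RightModule A} (f : M ⟶ M')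
    (g : X ⟶ (H.flip.obj N).obj (op M')) :
    (iHomEquiv adj X M N).symm (g ≫ (H.flip.obj N).map f.op) =
      tensorHomRight X f ≫ (iHomEquiv adj X M' N).symm g := by
  rw [Equiv.symm_apply_eq, iHomEquiv_naturality_middle, Equiv.apply_symm_apply]

/-- The internal Hom from `M` to `Y ⊗ N` is the tensor product of `Y` with the internal Hom from
`M` to `N`, naturally in `M`. -/
def iHomTensorIso (Y Y' : C) [ExactPairing Y Y'] (N : RightModule A) :
    H.flip.obj (tensor Y N) ≅ H.flip.obj N ⋙ tensorLeft Y :=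
  isoOfHomEquiv
    -- Hom(X, Hom(M, Y ⊗ N)) = Hom(X ⊗ M, Y ⊗ N) = Hom(Y' ⊗ (X ⊗ M), N) = Hom((Y' ⊗ X) ⊗ M, N) =
    -- Hom(Y' ⊗ X, Hom(M, N)) = Hom(X, Y ⊗ Hom(M, N)).
    (fun X M => (iHomEquiv adj X M.unop (tensor Y N)).symm.trans
      ((tensorHomEquiv Y Y' (tensor X M.unop) N).symm.trans
        ((Iso.homCongr (tensorAssoc Y' X M.unop).symm (Iso.refl N)).trans
          ((iHomEquiv adj (Y' ⊗ X) M.unop N).trans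
            (tensorLeftHomEquiv X Y Y' ((H.flip.obj N).obj M))))))
    (fun {X X'} M f g => by
      simp only [Equiv.trans_apply]
      rw [← Equiv.eq_symm_apply, tensorLeftHomEquiv_symm_naturality, Equiv.symm_apply_apply,
        ← iHomEquiv_naturality_left, iHomEquiv_symm_naturality_left,
        tensorHomEquiv_symm_naturality_left]
      simp only [Iso.homCongr_apply, Iso.symm_inv, Iso.refl_hom, Category.comp_id,
        reassoc_of% tensorHomLeft_tensorAssoc_hom])
    (fun {X M M'} φ g => by
      obtain ⟨φ, rfl⟩ : ∃ ψ, φ = Quiver.Hom.op ψ := ⟨φ.unop, rfl⟩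
      simp only [Equiv.trans_apply]
      refine Eq.trans ?_ (tensorLeftHomEquiv_naturality _ _)
      rw [← iHomEquiv_naturality_middle, iHomEquiv_symm_naturality_middle,
        tensorHomEquiv_symm_naturality_left]
      simp only [Iso.homCongr_apply, Iso.symm_inv, Iso.refl_hom, Category.comp_id,
        reassoc_of% tensorHomRight_tensorAssoc_hom])

/-- The internal Hom functor into `N` turns finite colimits of right modules into limits. -/
theorem preservesLimits_iHom
    (adj : (MonoidalLeftAction.curriedAction C (RightModule A)).flip ⊣₂ H)
    [LeftRigidCategory C] (N : RightModule A) :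
    PreservesLimitsOfSize.{v₁, u₁} (H.flip.obj N) := by
  -- Since Hom(X ⊗ M, N) = Hom(M, ᘁX ⊗ N), the functor is a right adjoint on the opposite category,
  -- with left adjoint X ↦ ᘁX ⊗ N.
  refine (Adjunction.adjunctionOfEquivLeft (F_obj := fun X : C => op (tensor (ᘁX : C) N))
    (fun X M => ((opEquiv _ _).trans ((tensorHomEquiv (ᘁX : C) X M.unop N).symm.trans
      (iHomEquiv adj X M.unop N)))) ?_).rightAdjoint_preservesLimits
  intro X M M' φ f
  obtain ⟨φ, rfl⟩ : ∃ ψ, φ = Quiver.Hom.op ψ := ⟨φ.unop, rfl⟩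
  simp only [Equiv.trans_apply]
  refine Eq.trans ?_ (iHomEquiv_naturality_middle adj _ _)
  refine congrArg _ ?_
  rw [Equiv.symm_apply_eq, tensorHomEquiv_naturality_left, Equiv.apply_symm_apply]
  rfl

end InternalHom

end RightModule

/-! ### Construction of internal Homs -/

section

variable {C₁ : Type u} [Category.{v} C₁] {C₂ : Type u₁} [Category.{v₁} C₂]
  {C₃ : Type u₂} [Category.{v₂} C₃]

/-- Objectwise right adjoints of a bifunctor assemble into a bifunctor. -/
@[simps]
def rightAdjointBifunctor {F : C₁ ⥤ C₂ ⥤ C₃} {R : C₁ → C₃ ⥤ C₂} (adj : ∀ X, F.obj X ⊣ R X) :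
    C₁ᵒᵖ ⥤ C₃ ⥤ C₂ where
  obj X := R X.unop
  map f := conjugateEquiv (adj _) (adj _) (F.map f.unop)
  map_id X := by simp
  map_comp f g := by simp

/-- Objectwise adjunctions assemble into a parametrized adjunction. -/
def parametrizedAdjunctionOfAdjunctions {F : C₁ ⥤ C₂ ⥤ C₃} {R : C₁ → C₃ ⥤ C₂}
    (adj : ∀ X, F.obj X ⊣ R X) : F ⊣₂ rightAdjointBifunctor adj where
  adj X := adj X
  unit_whiskerRight_map {X Y} f := by
    ext Z
    exact (unit_conjugateEquiv (adj Y) (adj X) (F.map f) Z).symm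

end

namespace RightModule

variable {C : Type u} [Category.{v} C] [MonoidalCategory C] {A : C} [MonObj A]

section

variable [RightRigidCategory C] (M N : RightModule A)

/-- The universal morphism `(N ⊗ M*) ⊗ M ⟶ N`. -/
def dualEval : (N.X ⊗ M.Xᘁ) ⊗ M.X ⟶ N.X :=
  (tensorRightHomEquiv _ M.X M.Xᘁ N.X).symm (𝟙 _)

variable {M N} in
theorem whiskerRight_dualEval {X : C} (g : X ⟶ N.X ⊗ M.Xᘁ) :
    g ▷ M.X ≫ dualEval M N = (tensorRightHomEquiv X M.X M.Xᘁ N.X).symm g := by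
  rw [dualEval, ← tensorRightHomEquiv_symm_naturality, Category.comp_id]

/-- Precomposition with the action of `A` on `M`. -/
def preAct : N.X ⊗ M.Xᘁ ⟶ N.X ⊗ (M.X ⊗ A)ᘁ :=
  tensorRightHomEquiv _ (M.X ⊗ A) _ N.X ((N.X ⊗ M.Xᘁ) ◁ M.act ≫ dualEval M N)

/-- Tensoring with `A` and postcomposition with the action of `A` on `N`. -/
def postAct : N.X ⊗ M.Xᘁ ⟶ N.X ⊗ (M.X ⊗ A)ᘁ :=
  tensorRightHomEquiv _ (M.X ⊗ A) _ N.X ((α_ _ _ _).inv ≫ dualEval M N ▷ A ≫ N.act)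

variable {M N} in
-- Undoing the duality turns the two composites into "act on M, then f" and "f ⊗ A, then act on N".
-- The A-linear maps are therefore those whose transposes equalize `preAct` and `postAct`, which is
-- why the equalizer is the internal Hom.
theorem comp_preAct_eq_iff {X : C} (f : X ⊗ M.X ⟶ N.X) :
    tensorRightHomEquiv X M.X M.Xᘁ N.X f ≫ preAct M N =
        tensorRightHomEquiv X M.X M.Xᘁ N.X f ≫ postAct M N ↔
      ((α_ X M.X A).hom ≫ X ◁ M.act) ≫ f = f ▷ A ≫ N.act := by
  have h := whiskerRight_dualEval (tensorRightHomEquiv X M.X M.Xᘁ N.X f)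
  rw [Equiv.symm_apply_apply] at h
  rw [← (tensorRightHomEquiv X (M.X ⊗ A) _ N.X).symm.injective.eq_iff,
    tensorRightHomEquiv_symm_naturality, tensorRightHomEquiv_symm_naturality, preAct, postAct,
    Equiv.symm_apply_apply, Equiv.symm_apply_apply, ← whisker_exchange_assoc, h,
    whiskerRight_tensor, Category.assoc, Category.assoc, Iso.hom_inv_id_assoc,
    ← comp_whiskerRight_assoc, h, ← cancel_epi (α_ X M.X A).hom, Iso.hom_inv_id_assoc,
    Category.assoc]

variable [HasEqualizers C]

/-- The internal Hom of right modules. -/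
noncomputable abbrev homObj : C := equalizer (preAct M N) (postAct M N)

/-- The universal property of the internal Hom of right modules. -/
noncomputable abbrev homObjEquiv (X : C) : (tensor X M ⟶ N) ≃ (X ⟶ homObj M N) where
  toFun f := equalizer.lift (tensorRightHomEquiv X M.X M.Xᘁ N.X f.hom)
    ((comp_preAct_eq_iff f.hom).2 f.act_hom)
  invFun g := ⟨(tensorRightHomEquiv X M.X M.Xᘁ N.X).symm (g ≫ equalizer.ι (preAct M N) _),
    (comp_preAct_eq_iff _).1 (by
      rw [Equiv.apply_symm_apply, Category.assoc, equalizer.condition, Category.assoc])⟩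
  left_inv f := by
    ext
    exact (congrArg _ (equalizer.lift_ι _ _)).trans (Equiv.symm_apply_apply _ _)
  right_inv g := by
    apply equalizer.hom_ext
    rw [equalizer.lift_ι]
    exact Equiv.apply_symm_apply _ _

theorem homObjEquiv_naturality {X' X : C} (f : X' ⟶ X) (g : tensor X M ⟶ N) :
    homObjEquiv M N X' (tensorHomLeft f M ≫ g) = f ≫ homObjEquiv M N X g := by
  apply equalizer.hom_ext
  refine (equalizer.lift_ι _ _).trans (Eq.trans ?_ (Category.assoc _ _ _).symm)
  refine Eq.trans ?_ (congrArg (f ≫ ·) (equalizer.lift_ι _ _)).symm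
  have h : (tensorRightHomEquiv X' M.X M.Xᘁ N.X).symm
      (f ≫ tensorRightHomEquiv X M.X M.Xᘁ N.X g.hom) = f ▷ M.X ≫ g.hom :=
    (tensorRightHomEquiv_symm_naturality _ _).trans
      (congrArg (f ▷ M.X ≫ ·) (Equiv.symm_apply_apply _ _))
  exact ((Equiv.symm_apply_eq _).1 h).symm

/-- The action of `C` on a right module `M` is left adjoint to the internal Hom from `M`. -/
noncomputable def actionRightAdjunction :
    (MonoidalLeftAction.curriedAction C (RightModule A)).flip.obj M ⊣
      Adjunction.rightAdjointOfEquiv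
        (F := (MonoidalLeftAction.curriedAction C (RightModule A)).flip.obj M)
        (fun X N => homObjEquiv M N X) (fun _ _ _ f g => homObjEquiv_naturality M _ f g) :=
  Adjunction.adjunctionOfEquivRight _ _

end

/-- Quasi-Frobenius includes the existence of an internal Hom, which for modules over F(A) has to be
constructed. -/
theorem exists_iHom [RightRigidCategory C] [HasEqualizers C] (A : C) [MonObj A] :
    ∃ H : (RightModule A)ᵒᵖ ⥤ RightModule A ⥤ C,
      Nonempty ((MonoidalLeftAction.curriedAction C (RightModule A)).flip ⊣₂ H) :=
  ⟨_, ⟨parametrizedAdjunctionOfAdjunctions fun M => actionRightAdjunction M⟩⟩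

/-! ### Dual modules -/

/-- The right module `E` is dual to the left module `A`. -/
class IsDual (E : RightModule A) [ExactPairing A E.X] : Prop where
  act_evaluation : E.act ▷ A ≫ ExactPairing.evaluation A E.X =
    (α_ E.X A A).hom ≫ E.X ◁ μ[A] ≫ ExactPairing.evaluation A E.X

/-- Nondegeneracy of the evaluation pairing: it reduces the module axioms for the dual to identities
between pairings. -/
theorem eq_of_whiskerRight_evaluation {A B Z : C} [ExactPairing A B] {f g : Z ⟶ B}
    (h : f ▷ A ≫ ExactPairing.evaluation A B = g ▷ A ≫ ExactPairing.evaluation A B) : f = g := by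
  rw [← cancel_mono (λ_ B).inv]
  apply (tensorRightHomEquiv Z A B (𝟙_ C)).symm.injective
  simp [tensorRightHomEquiv, reassoc_of% h]

/-- The right action of `A` on its dual. -/
def dualAct (A : C) [MonObj A] [HasRightDual A] : Aᘁ ⊗ A ⟶ Aᘁ :=
  tensorRightHomEquiv (Aᘁ ⊗ A) A Aᘁ (𝟙_ C)
    ((α_ _ _ _).hom ≫ (Aᘁ : C) ◁ μ[A] ≫ ExactPairing.evaluation A Aᘁ) ≫ (λ_ _).hom

/-- In elements, ⟨φa, b⟩ = ⟨φ, ab⟩. -/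
theorem dualAct_evaluation (A : C) [MonObj A] [HasRightDual A] :
    dualAct A ▷ A ≫ ExactPairing.evaluation A Aᘁ =
      (α_ _ _ _).hom ≫ (Aᘁ : C) ◁ μ[A] ≫ ExactPairing.evaluation A Aᘁ := by
  have h := (tensorRightHomEquiv (Aᘁ ⊗ A) A Aᘁ (𝟙_ C)).symm_apply_apply
    ((α_ _ _ _).hom ≫ (Aᘁ : C) ◁ μ[A] ≫ ExactPairing.evaluation A Aᘁ)
  rw [← h, dualAct]
  simp [tensorRightHomEquiv, unitors_inv_equal]

/-- The dual of the algebra `A`, as a right module. -/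
@[simps]
def dual (A : C) [MonObj A] [HasRightDual A] : RightModule A where
  X := Aᘁ
  act := dualAct A
  act_one := by
    apply eq_of_whiskerRight_evaluation (A := A)
    rw [comp_whiskerRight, Category.assoc, dualAct_evaluation, associator_naturality_middle_assoc,
      ← MonoidalCategory.whiskerLeft_comp_assoc, MonObj.one_mul]
    simp
  act_mul := by
    apply eq_of_whiskerRight_evaluation (A := A)
    simp only [comp_whiskerRight, Category.assoc, dualAct_evaluation,
      associator_naturality_middle_assoc, associator_naturality_left_assoc]
    rw [← whisker_exchange_assoc, dualAct_evaluation,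
      ← MonoidalCategory.whiskerLeft_comp_assoc, MonObj.mul_assoc]
    simp

instance (A : C) [MonObj A] [HasRightDual A] : ExactPairing A (dual A).X :=
  inferInstanceAs (ExactPairing A Aᘁ)

instance (A : C) [MonObj A] [HasRightDual A] : IsDual (dual A) :=
  ⟨dualAct_evaluation A⟩

/-! ### Cofree modules -/

section

variable (E : RightModule A) [ExactPairing A E.X]

/-- The functional on the dual of `A` given by evaluation at the unit. -/
def counit : E.X ⟶ 𝟙_ C := (ρ_ _).inv ≫ E.X ◁ η[A] ≫ ExactPairing.evaluation A E.X

/-- In elements, ⟨φa, 1⟩ = ⟨φ, a1⟩ = ⟨φ, a⟩. -/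
theorem act_counit [IsDual E] : E.act ≫ counit E = ExactPairing.evaluation A E.X := by
  rw [counit, rightUnitor_inv_naturality_assoc, ← whisker_exchange_assoc, IsDual.act_evaluation]
  simp [← MonoidalCategory.whiskerLeft_comp_assoc]

/-- A linear map into X ⊗ E is recovered from its composite with the counit: pairing f(z) with a is
the same as evaluating f(za) at 1. -/
theorem tensorRightHomEquiv_symm_eq [IsDual E] {X Z : C} {a : Z ⊗ A ⟶ Z} {f : Z ⟶ X ⊗ E.X}
    (h : a ≫ f = f ▷ A ≫ (α_ X E.X A).hom ≫ X ◁ E.act) :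
    (tensorRightHomEquiv Z A E.X X).symm f = a ≫ f ≫ X ◁ counit E ≫ (ρ_ X).hom := by
  rw [reassoc_of% h, ← MonoidalCategory.whiskerLeft_comp_assoc, act_counit]
  rfl

variable {E} in
theorem tensorRightHomEquiv_comp_counit {X Z : C} (h : Z ⊗ A ⟶ X) :
    tensorRightHomEquiv Z A E.X X h ≫ X ◁ counit E ≫ (ρ_ X).hom =
      (ρ_ Z).inv ≫ Z ◁ η[A] ≫ h := by
  obtain ⟨f, rfl⟩ := (tensorRightHomEquiv Z A E.X X).symm.surjective h
  rw [Equiv.apply_symm_apply]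
  simp only [tensorRightHomEquiv, counit, Equiv.coe_fn_symm_mk]
  rw [whisker_exchange_assoc]
  simp

/-- The module `X ⊗ E` is cofree on `X` if `E` is dual to `A`. -/
def toTensorDualEquiv [IsDual E] (M : RightModule A) (X : C) :
    (M ⟶ tensor X E) ≃ (M.X ⟶ X) where
  toFun f := f.hom ≫ X ◁ counit E ≫ (ρ_ X).hom
  -- The inverse sends g to m ↦ (a ↦ g(ma)); after transposition its linearity is (ma)b = m(ab).
  invFun g := ⟨tensorRightHomEquiv M.X A E.X X (M.act ≫ g), by
    obtain ⟨f, hf⟩ : ∃ f, f = tensorRightHomEquiv M.X A E.X X (M.act ≫ g) := ⟨_, rfl⟩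
    have h : f ▷ A ≫ (α_ X E.X A).hom ≫ X ◁ ExactPairing.evaluation A E.X ≫ (ρ_ X).hom =
        M.act ≫ g := (Equiv.symm_apply_eq _).2 hf
    rw [← hf]
    change M.act ≫ f = f ▷ A ≫ (α_ X E.X A).hom ≫ X ◁ E.act
    apply (tensorRightHomEquiv (M.X ⊗ A) A E.X X).symm.injective
    simp only [tensorRightHomEquiv, Equiv.coe_fn_symm_mk, comp_whiskerRight, Category.assoc, h,
      associator_naturality_middle_assoc]
    rw [← MonoidalCategory.whiskerLeft_comp_assoc X (E.act ▷ A), IsDual.act_evaluation]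
    have hm : M.act ▷ A ≫ M.act = (α_ M.X A A).hom ≫ M.X ◁ μ[A] ≫ M.act := by
      rw [M.act_mul, Iso.hom_inv_id_assoc]
    rw [reassoc_of% hm, ← h, whisker_exchange_assoc]
    simp⟩
  left_inv f := by
    ext
    refine (congrArg (tensorRightHomEquiv M.X A E.X X)
      (tensorRightHomEquiv_symm_eq E f.act_hom).symm).trans ?_
    exact Equiv.apply_symm_apply _ _
  right_inv g := by
    refine (tensorRightHomEquiv_comp_counit _).trans ?_
    rw [reassoc_of% M.act_one, Iso.inv_hom_id_assoc]

theorem toTensorDualEquiv_naturality_left [IsDual E] {M M' : RightModule A} {X : C} (φ : M ⟶ M')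
    (f : M' ⟶ tensor X E) :
    toTensorDualEquiv E M X (φ ≫ f) = φ.hom ≫ toTensorDualEquiv E M' X f :=
  Category.assoc _ _ _

/-- Every right module embeds into a cofree one. -/
theorem mono_toTensorDualEquiv_symm [IsDual E] (M : RightModule A) :
    Mono ((toTensorDualEquiv E M M.X).symm (𝟙 _)) where
  right_cancellation {Z} f g h := by
    have := congrArg (toTensorDualEquiv E Z M.X) h
    simp only [toTensorDualEquiv_naturality_left, Equiv.apply_symm_apply] at this
    ext
    exact (Category.comp_id _).symm.trans (this.trans (Category.comp_id _))

end

end RightModule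

namespace RightModule

variable {C : Type u} [Category.{v} C] [MonoidalCategory C] {A : C} [MonObj A]

/-! ### Internal Homs into cofree modules -/

/-- The forgetful functor from right modules. -/
@[simps]
def forget (A : C) [MonObj A] : RightModule A ⥤ C where
  obj M := M.X
  map f := f.hom

/-- The free right module. -/
@[simps!]
def free (A : C) [MonObj A] (X : C) : RightModule A := tensor X (regular A)

/-- A linear map out of X ⊗ A is determined on X ⊗ 1, since h(x ⊗ a) = h(x ⊗ 1)a. -/
theorem unit_comp_whiskerRight_act {X Z : C} {a : Z ⊗ A ⟶ Z} {h : X ⊗ A ⟶ Z}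
    (hh : ((α_ X A A).hom ≫ X ◁ μ[A]) ≫ h = h ▷ A ≫ a) :
    ((ρ_ X).inv ≫ X ◁ η[A] ≫ h) ▷ A ≫ a = h := by
  rw [comp_whiskerRight, comp_whiskerRight, Category.assoc, Category.assoc, ← hh,
    Category.assoc, associator_naturality_middle_assoc, ← MonoidalCategory.whiskerLeft_comp_assoc,
    MonObj.one_mul]
  simp

theorem unit_comp_act {X : C} {M : RightModule A} (g : X ⟶ M.X) :
    (ρ_ X).inv ≫ X ◁ η[A] ≫ g ▷ A ≫ M.act = g := by
  rw [whisker_exchange_assoc, M.act_one]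
  simp

/-- The universal property of free modules. -/
def freeEquiv (X : C) (M : RightModule A) : (free A X ⟶ M) ≃ (X ⟶ M.X) where
  toFun f := (ρ_ X).inv ≫ X ◁ η[A] ≫ f.hom
  invFun g := ⟨g ▷ A ≫ M.act, by
    change ((α_ X A A).hom ≫ X ◁ μ[A]) ≫ g ▷ A ≫ M.act = (g ▷ A ≫ M.act) ▷ A ≫ M.act
    rw [comp_whiskerRight, Category.assoc, Category.assoc, whisker_exchange_assoc, M.act_mul]
    simp⟩
  left_inv f := hom_ext (unit_comp_whiskerRight_act f.act_hom)
  right_inv g := unit_comp_act g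

theorem freeEquiv_naturality {X : C} {M M' : RightModule A} (g : M ⟶ M') (h : free A X ⟶ M) :
    freeEquiv X M' (h ≫ g) = freeEquiv X M h ≫ g.hom := by
  refine Eq.trans ?_ (Category.assoc _ _ _).symm
  exact congrArg ((ρ_ X).inv ≫ ·) (Category.assoc _ _ _).symm

/-- Being right adjoint to the free module functor, `forget A` preserves limits, so its opposite
preserves colimits. -/
instance (A : C) [MonObj A] : (forget A).IsRightAdjoint :=
  (Adjunction.adjunctionOfEquivLeft (G := forget A) freeEquiv
    (fun _ _ _ g h => freeEquiv_naturality g h)).isRightAdjoint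

end RightModule

/-! ### Duality as a contravariant functor -/

section

variable (C : Type u) [Category.{v} C] [MonoidalCategory C]

/-- Taking right duals, as a contravariant functor. -/
@[simps]
def rightDualOp [RightRigidCategory C] : Cᵒᵖ ⥤ C where
  obj X := (X.unopᘁ : C)
  map f := f.unopᘁ
  map_id _ := rightAdjointMate_id
  map_comp _ _ := comp_rightAdjointMate

variable {C} in
/-- Morphisms out of a right dual correspond to morphisms out of a left dual. -/
def dualHomEquiv [RigidCategory C] (X Z : C) : ((Xᘁ : C) ⟶ Z) ≃ ((ᘁZ : C) ⟶ X) :=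
  (Iso.homCongr (ρ_ (Xᘁ : C)).symm (Iso.refl Z)).trans
    ((tensorLeftHomEquiv (𝟙_ C) X Xᘁ Z).trans
      ((tensorRightHomEquiv (𝟙_ C) (ᘁZ) Z X).symm.trans
        (Iso.homCongr (λ_ (ᘁZ : C)) (Iso.refl X))))

variable {C} in
theorem dualHomEquiv_naturality [RigidCategory C] {X X' Z : C} (f : X ⟶ X')
    (g : (Xᘁ : C) ⟶ Z) :
    dualHomEquiv X' Z ((fᘁ) ≫ g) = dualHomEquiv X Z g ≫ f := by
  obtain ⟨g, rfl⟩ := (dualHomEquiv X Z).symm.surjective g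
  rw [Equiv.apply_symm_apply, ← Equiv.eq_symm_apply]
  simp [dualHomEquiv, tensorLeftHomEquiv, tensorRightHomEquiv]
  rw [associator_inv_naturality_middle_assoc _ f, ← comp_whiskerRight_assoc (_ ◁ f),
    ← rightAdjointMate_comp_evaluation, comp_whiskerRight, Category.assoc,
    rightUnitor_inv_naturality_assoc, ← whisker_exchange_assoc, ← whisker_exchange_assoc,
    associator_inv_naturality_left_assoc]

/-- The right adjoint is the left dual; hence X ↦ X* turns limits into colimits. -/
instance [RigidCategory C] : (rightDualOp C).IsLeftAdjoint :=
  (Adjunction.adjunctionOfEquivRight (F := rightDualOp C) (G_obj := fun Z => op (ᘁZ : C))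
    (fun X Z => (dualHomEquiv X.unop Z).trans (opEquiv (op _) (op _)).symm)
    (fun _ _ _ f g => congrArg Quiver.Hom.op (dualHomEquiv_naturality f.unop g))).isLeftAdjoint

end

namespace RightModule

variable {C : Type u} [Category.{v} C] [MonoidalCategory C] {A : C} [MonObj A]

theorem tensorRightHomEquiv_whiskerLeft {X Y M M' : C} [HasRightDual M] [HasRightDual M']
    (φ : M ⟶ M') (g : X ⊗ M' ⟶ Y) :
    tensorRightHomEquiv X M (Mᘁ) Y (X ◁ φ ≫ g) =
      tensorRightHomEquiv X M' (M'ᘁ) Y g ≫ Y ◁ (φᘁ) := by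
  obtain ⟨g, rfl⟩ := (tensorRightHomEquiv X M' (M'ᘁ) Y).symm.surjective g
  rw [Equiv.apply_symm_apply, ← Equiv.eq_symm_apply]
  simp only [tensorRightHomEquiv, Equiv.coe_fn_symm_mk, comp_whiskerRight, Category.assoc]
  rw [associator_naturality_middle_assoc, ← MonoidalCategory.whiskerLeft_comp_assoc,
    rightAdjointMate_comp_evaluation, whisker_exchange_assoc]
  simp

section

variable [RightRigidCategory C] (E : RightModule A) [ExactPairing A E.X] [IsDual E]

/-- Morphisms from `X ⊗ M` to the cofree module on `Y`. -/
def tensorHomTensorDualEquiv (X Y : C) (M : RightModule A) :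
    (tensor X M ⟶ tensor Y E) ≃ (X ⟶ Y ⊗ M.Xᘁ) :=
  (toTensorDualEquiv E (tensor X M) Y).trans (tensorRightHomEquiv X M.X M.Xᘁ Y)

theorem tensorHomTensorDualEquiv_naturality_left {X X' Y : C} {M : RightModule A} (f : X ⟶ X')
    (g : tensor X' M ⟶ tensor Y E) :
    tensorHomTensorDualEquiv E X Y M (tensorHomLeft f M ≫ g) =
      f ≫ tensorHomTensorDualEquiv E X' Y M g := by
  refine (congrArg (tensorRightHomEquiv X M.X M.Xᘁ Y)
    (toTensorDualEquiv_naturality_left E (tensorHomLeft f M) g)).trans ?_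
  refine (Equiv.eq_symm_apply (tensorRightHomEquiv X M.X M.Xᘁ Y)).1 ?_
  refine Eq.trans ?_ (tensorRightHomEquiv_symm_naturality _ _).symm
  exact congrArg (f ▷ M.X ≫ ·) (Equiv.symm_apply_apply _ _).symm

theorem tensorHomTensorDualEquiv_naturality_middle {X Y : C} {M M' : RightModule A} (φ : M ⟶ M')
    (g : tensor X M' ⟶ tensor Y E) :
    tensorHomTensorDualEquiv E X Y M (tensorHomRight X φ ≫ g) =
      tensorHomTensorDualEquiv E X Y M' g ≫ Y ◁ (φ.homᘁ) :=
  (congrArg (tensorRightHomEquiv X M.X M.Xᘁ Y)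
    (toTensorDualEquiv_naturality_left E (tensorHomRight X φ) g)).trans
      (tensorRightHomEquiv_whiskerLeft φ.hom _)

/-- The internal Hom from `M` to the cofree module on `Y` is the tensor product of `Y` with the
dual of `M`. -/
def iHomTensorDualIso {H : (RightModule A)ᵒᵖ ⥤ RightModule A ⥤ C}
    (adj : (MonoidalLeftAction.curriedAction C (RightModule A)).flip ⊣₂ H) (Y : C) :
    H.flip.obj (tensor Y E) ≅ (forget A).op ⋙ rightDualOp C ⋙ tensorLeft Y :=
  isoOfHomEquiv
    (fun X M => (iHomEquiv adj X M.unop (tensor Y E)).symm.trans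
      (tensorHomTensorDualEquiv E X Y M.unop))
    (fun _ f g => (congrArg _ (iHomEquiv_symm_naturality_left adj f g)).trans
      (tensorHomTensorDualEquiv_naturality_left E f _))
    (fun φ g => (congrArg _ (iHomEquiv_symm_naturality_middle adj φ.unop g)).trans
      (tensorHomTensorDualEquiv_naturality_middle E φ.unop _))

end

/-- The functor is M ↦ Y ⊗ M*, a composite of the opposite of the forgetful functor, duality, and Y
⊗ -; each preserves finite colimits. -/
theorem preservesFiniteColimits_iHom_tensor_dual [RigidCategory C]
    {H : (RightModule A)ᵒᵖ ⥤ RightModule A ⥤ C}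
    (adj : (MonoidalLeftAction.curriedAction C (RightModule A)).flip ⊣₂ H)
    (E : RightModule A) [ExactPairing A E.X] [IsDual E] (Y : C) :
    PreservesFiniteColimits (H.flip.obj (tensor Y E)) := by
  have : PreservesFiniteLimits (forget A) :=
    ⟨fun _ _ _ => (Adjunction.ofIsRightAdjoint (forget A)).rightAdjoint_preservesLimits.1⟩
  have := preservesFiniteColimits_op (forget A)
  have : PreservesFiniteColimits (rightDualOp C ⋙ tensorLeft Y) := by
    have : (tensorLeft Y).IsLeftAdjoint := (tensorLeftAdjunction (ᘁY : C) Y).isLeftAdjoint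
    infer_instance
  exact preservesFiniteColimits_of_natIso (iHomTensorDualIso E adj Y).symm

end RightModule

/-! ### Right modules and monoidal functors -/

namespace RightModule

variable {C : Type u₁} [Category.{v₁} C] [MonoidalCategory C] {D : Type u₂} [Category.{v₂} D]
  [MonoidalCategory D] (F : C ⥤ D) [F.Monoidal] {A : C} [MonObj A]

/-- The image of a right `A`-module under a monoidal functor `F`, as a right `F(A)`-module. -/
@[simps]
def mapObj (M : RightModule A) : RightModule (F.obj A) where
  X := F.obj M.X
  act := Functor.LaxMonoidal.μ F M.X A ≫ F.map M.act
  act_one := by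
    rw [Functor.obj.η_def, MonoidalCategory.whiskerLeft_comp, Category.assoc,
      Functor.LaxMonoidal.μ_natural_right_assoc, ← F.map_comp, M.act_one]
    simp
  act_mul := by
    rw [Functor.obj.μ_def, MonoidalCategory.whiskerLeft_comp, Category.assoc,
      Functor.LaxMonoidal.μ_natural_right_assoc, ← F.map_comp, M.act_mul, comp_whiskerRight,
      Category.assoc, Functor.LaxMonoidal.μ_natural_left_assoc]
    simp

/-- A monoidal functor `F` induces a functor from right `A`-modules to right `F(A)`-modules. -/
@[simps]
def mapFunctor (A : C) [MonObj A] : RightModule A ⥤ RightModule (F.obj A) where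
  obj M := mapObj F M
  map {M N} f := ⟨F.map f.hom, by
    change (Functor.LaxMonoidal.μ F M.X A ≫ F.map M.act) ≫ F.map f.hom =
      F.map f.hom ▷ F.obj A ≫ Functor.LaxMonoidal.μ F N.X A ≫ F.map N.act
    rw [Functor.LaxMonoidal.μ_natural_left_assoc, Category.assoc, ← F.map_comp, ← F.map_comp,
      f.act_hom]⟩
  map_id M := hom_ext (F.map_id _)
  map_comp f g := hom_ext (F.map_comp _ _)

/-- A monoidal functor is compatible with the tensor product of objects and right modules. -/
def mapTensorIso (Y : C) (M : RightModule A) :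
    mapObj F (tensor Y M) ≅ tensor (F.obj Y) (mapObj F M) :=
  isoMk (Functor.Monoidal.μIso F Y M.X).symm (by
    change (Functor.LaxMonoidal.μ F (Y ⊗ M.X) A ≫ F.map ((α_ Y M.X A).hom ≫ Y ◁ M.act)) ≫
        Functor.OplaxMonoidal.δ F Y M.X = Functor.OplaxMonoidal.δ F Y M.X ▷ F.obj A ≫
        (α_ (F.obj Y) (F.obj M.X) (F.obj A)).hom ≫
          F.obj Y ◁ (Functor.LaxMonoidal.μ F M.X A ≫ F.map M.act)
    simp only [F.map_comp, Functor.Monoidal.map_whiskerLeft, Functor.Monoidal.map_associator,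
      Category.assoc, Functor.Monoidal.μ_δ_assoc, Functor.Monoidal.μ_δ, Category.comp_id,
      MonoidalCategory.whiskerLeft_comp])

/-- A monoidal functor preserves exact pairings. -/
abbrev mapExactPairing (X Y : C) [ExactPairing X Y] : ExactPairing (F.obj X) (F.obj Y) where
  coevaluation' := Functor.LaxMonoidal.ε F ≫ F.map (ExactPairing.coevaluation X Y) ≫
    Functor.OplaxMonoidal.δ F X Y
  evaluation' := Functor.LaxMonoidal.μ F Y X ≫ F.map (ExactPairing.evaluation X Y) ≫
    Functor.OplaxMonoidal.η F
  coevaluation_evaluation' := by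
    -- The image under F of the zigzag identity in `C`, framed by structure isomorphisms of F that
    -- then cancel.
    have h := congrArg (fun f => F.obj Y ◁ Functor.LaxMonoidal.ε F ≫
      Functor.LaxMonoidal.μ F Y (𝟙_ C) ≫ F.map f ≫ Functor.OplaxMonoidal.δ F (𝟙_ C) Y ≫
        Functor.OplaxMonoidal.η F ▷ F.obj Y) (ExactPairing.coevaluation_evaluation X Y)
    simp only [F.map_comp, Functor.Monoidal.map_whiskerLeft, Functor.Monoidal.map_whiskerRight,
      Functor.Monoidal.map_associator_inv, Category.assoc, Functor.Monoidal.map_rightUnitor,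
      Functor.Monoidal.map_leftUnitor_inv, Functor.Monoidal.μ_δ_assoc,
      Functor.Monoidal.whiskerLeft_ε_η_assoc, Functor.Monoidal.whiskerRight_ε_η,
      Category.comp_id] at h
    simpa only [MonoidalCategory.whiskerLeft_comp, comp_whiskerRight, Category.assoc] using h
  evaluation_coevaluation' := by
    have h := congrArg (fun f => Functor.LaxMonoidal.ε F ▷ F.obj X ≫
      Functor.LaxMonoidal.μ F (𝟙_ C) X ≫ F.map f ≫ Functor.OplaxMonoidal.δ F X (𝟙_ C) ≫
        F.obj X ◁ Functor.OplaxMonoidal.η F) (ExactPairing.evaluation_coevaluation X Y)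
    simp only [F.map_comp, Functor.Monoidal.map_whiskerLeft, Functor.Monoidal.map_whiskerRight,
      Functor.Monoidal.map_associator, Category.assoc, Functor.Monoidal.map_leftUnitor,
      Functor.Monoidal.map_rightUnitor_inv, Functor.Monoidal.μ_δ_assoc,
      Functor.Monoidal.whiskerRight_ε_η_assoc, Functor.Monoidal.whiskerLeft_ε_η,
      Category.comp_id] at h
    simpa only [MonoidalCategory.whiskerLeft_comp, comp_whiskerRight, Category.assoc] using h

instance (E : RightModule A) [ExactPairing A E.X] :
    ExactPairing (F.obj A) (mapObj F E).X := mapExactPairing F A E.X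

/-- Duality is expressed by an identity between pairings, so F(E) is dual to F(A) without being
identified with a chosen dual of F(A). -/
instance (E : RightModule A) [ExactPairing A E.X] [IsDual E] : IsDual (mapObj F E) where
  act_evaluation := by
    change (Functor.LaxMonoidal.μ F E.X A ≫ F.map E.act) ▷ F.obj A ≫
        Functor.LaxMonoidal.μ F E.X A ≫ F.map (ExactPairing.evaluation A E.X) ≫
          Functor.OplaxMonoidal.η F = (α_ (F.obj E.X) (F.obj A) (F.obj A)).hom ≫
        F.obj E.X ◁ (Functor.LaxMonoidal.μ F A A ≫ F.map μ[A]) ≫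
        Functor.LaxMonoidal.μ F E.X A ≫ F.map (ExactPairing.evaluation A E.X) ≫
          Functor.OplaxMonoidal.η F
    rw [comp_whiskerRight, Category.assoc, Functor.LaxMonoidal.μ_natural_left_assoc,
      ← F.map_comp_assoc, IsDual.act_evaluation]
    simp

end RightModule

/-! ### Quasi-Frobenius algebras -/

/-- The regular module R is projective. If it were zero, then 1 = 0 in R and every module would
vanish, contrary to the nonzero `X`. -/
theorem exists_projective_nonzero {k : Type w} [Field k] {C : Type u} [Category.{v} C] [Abelian C]
    [Linear k C] (hC : IsFiniteAbelian k C) {X : C} (hX : ¬ IsZero X) :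
    ∃ P : C, Projective P ∧ ¬ IsZero P := by
  obtain ⟨R, _, _, _, e, -, -⟩ := hC
  have hP : Projective (FGModuleCat.of Rᵐᵒᵖ Rᵐᵒᵖ) :=
    (forget₂ (FGModuleCat Rᵐᵒᵖ) (ModuleCat Rᵐᵒᵖ)).projective_of_map_projective
      (ModuleCat.projective_of_categoryTheory_projective (ModuleCat.of Rᵐᵒᵖ Rᵐᵒᵖ))
  refine ⟨e.inverse.obj (FGModuleCat.of Rᵐᵒᵖ Rᵐᵒᵖ), e.symm.toAdjunction.map_projective _ hP,
    fun h => hX ?_⟩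
  have h' : IsZero (FGModuleCat.of Rᵐᵒᵖ Rᵐᵒᵖ) :=
    (e.functor.map_isZero h).of_iso (e.counitIso.app _).symm
  have h1 : (1 : Rᵐᵒᵖ) = 0 := by
    have := h'.eq_of_src (𝟙 _) 0
    exact congrArg (fun f : FGModuleCat.of Rᵐᵒᵖ Rᵐᵒᵖ ⟶ FGModuleCat.of Rᵐᵒᵖ Rᵐᵒᵖ =>
      f.hom.hom (1 : Rᵐᵒᵖ)) this
  have h2 : IsZero (e.functor.obj X) := by
    rw [IsZero.iff_id_eq_zero]
    ext x
    change x = 0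
    rw [← one_smul Rᵐᵒᵖ x, h1, zero_smul]
  exact (e.inverse.map_isZero h2).of_iso (e.unitIso.app X)

/-! ### Cancelling a nonzero tensor factor -/

section

variable {D : Type u} [Category.{v} D] [Abelian D] [MonoidalCategory D] [RigidCategory D]
  [MonoidalPreadditive D] [Simple (𝟙_ D)]

/-- By the zigzag identity the evaluation Q* ⊗ Q → 1 is nonzero, hence epi onto the simple unit. It
stays epi after - ⊗ X, so f is determined by Q* ⊗ Q ⊗ f. -/
theorem faithful_tensorLeft {Q : D} (hQ : ¬ IsZero Q) : (tensorLeft Q).Faithful := by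
  have hev : ExactPairing.evaluation Q Qᘁ ≠ 0 := fun h => hQ (by
    rw [IsZero.iff_id_eq_zero]
    have := ExactPairing.evaluation_coevaluation Q Qᘁ
    rw [h] at this
    rw [← cancel_epi (λ_ Q).hom, ← cancel_mono (ρ_ Q).inv]
    simpa using this.symm)
  have : Epi (ExactPairing.evaluation Q Qᘁ) := epi_of_nonzero_to_simple hev
  refine ⟨fun {X Y f g} h => ?_⟩
  change Q ◁ f = Q ◁ g at h
  have : (tensorRight X).IsLeftAdjoint := (tensorRightAdjunction X Xᘁ).isLeftAdjoint
  have : Epi (ExactPairing.evaluation Q Qᘁ ▷ X) :=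
    inferInstanceAs (Epi ((tensorRight X).map (ExactPairing.evaluation Q Qᘁ)))
  rw [← cancel_epi (λ_ X).hom, ← cancel_epi (ExactPairing.evaluation Q Qᘁ ▷ X),
    ← leftUnitor_naturality, ← leftUnitor_naturality, ← whisker_exchange_assoc,
    ← whisker_exchange_assoc, tensor_whiskerLeft, tensor_whiskerLeft, h]

/-- In an abelian category the faithful functor Q ⊗ - reflects isomorphisms; as it also preserves
colimits, it reflects finite ones. -/
theorem preservesFiniteColimits_of_comp_tensorLeft {J : Type u₁} [Category.{v₁} J] {G : J ⥤ D}
    {Q : D} (hQ : ¬ IsZero Q) [PreservesFiniteColimits (G ⋙ tensorLeft Q)] :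
    PreservesFiniteColimits G := by
  have := faithful_tensorLeft hQ
  have := (tensorLeftAdjunction (ᘁQ : D) Q).isLeftAdjoint
  have : (tensorLeft Q).ReflectsIsomorphisms := inferInstance
  refine ⟨fun K _ _ => ?_⟩
  have : ReflectsColimitsOfShape K (tensorLeft Q) :=
    reflectsColimitsOfShape_of_reflectsIsomorphisms
  exact preservesColimitsOfShape_of_reflects_of_preserves G (tensorLeft Q)

end

namespace RightModule

/-- If the regular module is relatively injective, its tensor product with a projective object is
a retract of a cofree module. -/
theorem exists_retract_of_isQuasiFrobenius {C : Type u} [Category.{v} C] [MonoidalCategory C]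
    [RigidCategory C] {A : C} [MonObj A] (hA : IsQuasiFrobenius A) (P : C) [Projective P] :
    Nonempty (Retract (tensor P (regular A)) (tensor (P ⊗ A) (dual A))) := by
  obtain ⟨H, ⟨adj⟩, -, _⟩ := hA
  let i : regular A ⟶ tensor A (dual A) := (toTensorDualEquiv (dual A) (regular A) A).symm (𝟙 _)
  have : Mono i := mono_toTensorDualEquiv_symm (dual A) (regular A)
  have : (tensorLeft P).IsLeftAdjoint := (tensorLeftAdjunction (ᘁP : C) P).isLeftAdjoint
  -- `i.op` is an epimorphism, and functors preserving finite colimits preserve epimorphisms.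
  have : Epi ((H.flip.obj (tensor P (regular A))).map i.op) := by
    have : PreservesFiniteColimits (H.flip.obj (tensor P (regular A))) :=
      preservesFiniteColimits_of_natIso (iHomTensorIso adj P Pᘁ (regular A)).symm
    infer_instance
  -- Projectivity of `P` lifts the transpose of the identity of P ⊗ A; transposing the lift back
  -- gives a retraction of P ⊗ i.
  let s := (iHomEquiv adj P _ _).symm (Projective.factorThru
    (iHomEquiv adj P (regular A) (tensor P (regular A)) (𝟙 _))
    ((H.flip.obj (tensor P (regular A))).map i.op))
  refine ⟨Retract.trans ⟨tensorHomRight P i, s, ?_⟩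
    (Retract.ofIso (tensorAssoc P A (dual A)).symm)⟩
  rw [← iHomEquiv_symm_naturality_middle, Projective.factorThru_comp, Equiv.symm_apply_apply]

end RightModule

open RightModule in
theorem mainTheorem10 (k : Type w) [Field k]
    {C : Type u₁} [Category.{v₁} C] [Abelian C] [Linear k C] [MonoidalCategory C]
    [RigidCategory C] [FiniteTensorCategory k C]
    {D : Type u₂} [Category.{v₂} D] [Abelian D] [Linear k D] [MonoidalCategory D]
    [RigidCategory D] [FiniteTensorCategory k D]
    (F : C ⥤ D) [F.Monoidal] [TensorFunctor k F]
    (A : C) [MonObj A] (hA : IsQuasiFrobenius A) :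
    IsQuasiFrobenius (F.obj A) := by
  have := FiniteTensorCategory.tensor_additive k (C := D)
  have := FiniteTensorCategory.simple_unit k (C := D)
  have := FiniteTensorCategory.simple_unit k (C := C)
  have := TensorFunctor.faithful k (F := F)
  obtain ⟨P, _, hP⟩ := exists_projective_nonzero (FiniteTensorCategory.finite (k := k) (C := C))
    (Simple.not_isZero (𝟙_ C))
  have hFP : ¬ IsZero (F.obj P) := fun h => hP (by
    rw [IsZero.iff_id_eq_zero]
    exact F.map_injective (h.eq_of_src _ _))
  obtain ⟨r⟩ := exists_retract_of_isQuasiFrobenius hA P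
  obtain ⟨H, ⟨adj⟩⟩ := exists_iHom (F.obj A)
  have r' : Retract (tensor (F.obj P) (regular (F.obj A)))
      (tensor (F.obj (P ⊗ A)) (mapObj F (dual A))) :=
    (Retract.ofIso (mapTensorIso F P (regular A)).symm).trans
      ((r.map (mapFunctor F A)).trans (Retract.ofIso (mapTensorIso F (P ⊗ A) (dual A))))
  have := preservesFiniteColimits_iHom_tensor_dual adj (mapObj F (dual A)) (F.obj (P ⊗ A))
  have := preservesFiniteColimits_of_retract (r'.map H.flip)
  have := preservesFiniteColimits_of_natIso
    (iHomTensorIso adj (F.obj P) (F.obj P)ᘁ (regular (F.obj A)))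
  -- Left exactness holds for every target module; only the colimit half needed the retract.
  have := preservesLimits_iHom adj (regular (F.obj A))
  exact ⟨H, ⟨adj⟩, inferInstance, preservesFiniteColimits_of_comp_tensorLeft hFP⟩
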